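/- Let $X$ be an infinite-dimensional real Banach space, let $W$ be a finite-dimensional linear subspace of the dual $X^*$, and let $p\in\{1,2,3,\dots\}\cup\{\infty\}$. A bump function on $X$ is a function $b:X\to\mathbb{R}$ that is not identically zero and whose support $\overline{\{x\in X: b(x)\neq 0\}}$ is bounded. Then the following are equivalent: 1. $X$ has a $C^p$ smooth bump function. 2. $X$ has a $C^p$ smooth bump function $f$ such that $\{\lambda f'(x): x\in X,\ \lambda\in\mathbb{R}\}\cap W=\{0\}$ and, moreover, $\{f'(x): x\in X,\ f(x)\neq 0\}\cap W=\emptyset$. The same equivalence holds if "$C^p$ smooth bump function" is replaced by "$C^p$ smooth Lipschitz bump function" in both (1) and (2). -/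

import Mathlib

/-- A real function on a normed space is a bump function if it is not identically zero and its
support (the closure of the set of points where it does not vanish) is bounded. -/
def IsBump {X : Type*} [NormedAddCommGroup X] (f : X → ℝ) : Prop :=
  (∃ x, f x ≠ 0) ∧ Bornology.IsBounded (tsupport f)

/-- All scaled derivatives `λ f'(x)` with `x ∈ X` and `λ ∈ ℝ`, as a subset of the dual `X^*`. -/
def scaledDerivatives {X : Type*} [NormedAddCommGroup X] [NormedSpace ℝ X] (f : X → ℝ) :
    Set (StrongDual ℝ X) :=
  {g | ∃ (x : X) (c : ℝ), g = c • fderiv ℝ f x}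

open Topology Filter
open scoped ContDiff

/-! Only (1) ⇒ (2) has content. In particular the new bump must have no critical point where it is
nonzero, so it can never attain its maximum. The construction is a spiral staircase that climbs
forever inside a bounded set.

Split off a plane `i(ℂ)` on which `W` vanishes, with projection `P` onto it, and an
infinite-dimensional `K ⊆ ker P` on which `W` also vanishes (`exists_plane_splitting`). Infinite
dimension provides a bounded Lipschitz path `c` in `K` whose points whole turns apart are at
distance more than twice the radius of the given bump `b` (`exists_bounded_path_far_turns`). At
height `s`, which is the argument of `P x` counted in turns, place a copy of `b` around `c s` and
multiply it by a strictly increasing bounded `a s`. The copies on different turns are disjoint, so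
summing over all heights (`periodize`) gives a function of the point alone, locally a single term. A
radial cutoff `β` removes the axis of the spiral.

At a point where this function is nonzero, rotate `P x` and move along `c` at the same time. The
factors `b` and `β` stay constant and `a` has positive derivative, while the velocity lies in `i(ℂ)
+ K`, which `W` annihilates. Hence the derivative is not in `W` (`exists_bump_fderiv_notMem`). Where
the nonnegative function vanishes it has a minimum and its derivative is `0`. -/

/-! ### Linear algebra: a plane and a complement annihilated by `W` -/

theorem LinearMap.not_finiteDimensional_ker {X V : Type*} [AddCommGroup X] [Module ℝ X]
    [AddCommGroup V] [Module ℝ V] [FiniteDimensional ℝ V] (hX : ¬ FiniteDimensional ℝ X)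
    (T : X →ₗ[ℝ] V) : ¬ FiniteDimensional ℝ (LinearMap.ker T) := by
  intro h
  have : FiniteDimensional ℝ (X ⧸ LinearMap.ker T) :=
    Module.Finite.equiv T.quotKerEquivRange.symm
  exact hX (Module.Finite.of_submodule_quotient (LinearMap.ker T))

theorem Submodule.exists_ne_zero_of_not_finiteDimensional {X : Type*} [AddCommGroup X]
    [Module ℝ X] {H : Submodule ℝ X} (hH : ¬ FiniteDimensional ℝ H) : ∃ e ∈ H, e ≠ 0 := by
  apply Submodule.exists_mem_ne_zero_of_ne_bot
  rintro rfl
  exact hH inferInstance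

/-- An infinite dimensional space splits off a plane on which a given finite dimensional space of
functionals vanishes; the functionals also vanish on an infinite dimensional subspace of the
complement. -/
theorem exists_plane_splitting {X : Type*} [NormedAddCommGroup X] [NormedSpace ℝ X]
    (hX : ¬ FiniteDimensional ℝ X) (W : Submodule ℝ (StrongDual ℝ X))
    (hW : FiniteDimensional ℝ W) :
    ∃ (P : X →L[ℝ] ℂ) (i : ℂ →L[ℝ] X) (K : Submodule ℝ X), (∀ z, P (i z) = z) ∧
      (∀ w ∈ W, ∀ z, w (i z) = 0) ∧ (∀ w ∈ W, ∀ x ∈ K, w x = 0) ∧ (∀ x ∈ K, P x = 0) ∧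
      ¬ FiniteDimensional ℝ K := by
  obtain ⟨S, hS⟩ : W.FG := W.fg_iff_finiteDimensional.2 hW
  let T : X →ₗ[ℝ] (S → ℝ) := LinearMap.pi fun w => ((w : StrongDual ℝ X) : X →ₗ[ℝ] ℝ)
  have hT : ∀ x, T x = 0 → ∀ w ∈ W, w x = 0 := by
    intro x hx w hw
    rw [← hS] at hw
    induction hw using Submodule.span_induction with
    | mem w hw => exact congrFun hx ⟨w, hw⟩
    | zero => rfl
    | add v w _ _ hv hw => simp [hv, hw]
    | smul c w _ hw => simp [hw]
  obtain ⟨e, heT, he⟩ :=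
    Submodule.exists_ne_zero_of_not_finiteDimensional (LinearMap.not_finiteDimensional_ker hX T)
  obtain ⟨u, hu⟩ := SeparatingDual.exists_eq_one (R := ℝ) he
  obtain ⟨g, hgT, hg⟩ := Submodule.exists_ne_zero_of_not_finiteDimensional
    (LinearMap.not_finiteDimensional_ker hX (T.prod (u : X →ₗ[ℝ] ℝ)))
  obtain ⟨v, hv⟩ := SeparatingDual.exists_eq_one (R := ℝ) hg
  have heT' : T e = 0 := heT
  have hgT' : T g = 0 ∧ u g = 0 := by simpa using hgT
  -- Subtracting `v e • u` makes the two coordinates biorthogonal to `e` and `g`, since `u e = 1`,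
  -- `u g = 0` and `v g = 1`.
  let P : X →L[ℝ] ℂ := Complex.equivRealProdCLM.symm.toContinuousLinearMap.comp
    (u.prod (v - v e • u))
  let i : ℂ →L[ℝ] X := Complex.reCLM.smulRight e + Complex.imCLM.smulRight g
  refine ⟨P, i, LinearMap.ker (T.prod (P : X →ₗ[ℝ] ℂ)), ?_, ?_, ?_, ?_,
    LinearMap.not_finiteDimensional_ker hX _⟩
  · intro z
    apply Complex.ext <;> simp [P, i, hu, hv, hgT'.2, mul_comm]
  · intro w hw z
    simp [i, hT e heT' w hw, hT g hgT'.1 w hw]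
  · intro w hw x hx
    have : T x = 0 ∧ P x = 0 := by simpa using hx
    exact hT x this.1 w hw
  · intro x hx
    have : T x = 0 ∧ P x = 0 := by simpa using hx
    exact this.2

/-! ### Bounded paths whose turns stay apart -/

theorem exists_unit_vector_far {E : Type*} [NormedAddCommGroup E] [NormedSpace ℝ E]
    (hE : ¬ FiniteDimensional ℝ E) (F : Submodule ℝ E) [FiniteDimensional ℝ F] :
    ∃ y : E, ‖y‖ = 1 ∧ ∀ v ∈ F, 1 / 2 ≤ ‖y - v‖ := by
  have hF : ∃ x, x ∉ F := by
    by_contra! h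
    have : F = ⊤ := by ext x; simp [h x]
    subst this
    exact hE (Module.Finite.equiv (Submodule.topEquiv (R := ℝ) (M := E)))
  obtain ⟨x, hx, h⟩ := riesz_lemma F.closed_of_finiteDimensional hF (r := 1 / 2) (by norm_num)
  have hx0 : x ≠ 0 := fun h0 => hx (h0 ▸ F.zero_mem)
  have hpos : 0 < ‖x‖ := norm_pos_iff.2 hx0
  refine ⟨‖x‖⁻¹ • x, ?_, fun v hv => ?_⟩
  · rw [norm_smul, norm_inv, norm_norm, inv_mul_cancel₀ hpos.ne']
  · have h1 := h (‖x‖ • v) (F.smul_mem _ hv)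
    have h2 : ‖x‖⁻¹ • x - v = ‖x‖⁻¹ • (x - ‖x‖ • v) := by
      rw [smul_sub, smul_smul, inv_mul_cancel₀ hpos.ne', one_smul]
    rw [h2, norm_smul, norm_inv, norm_norm, inv_mul_eq_div, le_div_iff₀ hpos]
    exact h1

/-- A sequence of unit vectors each of which is far from the span of its predecessors. -/
theorem exists_seq_far_from_span {E : Type*} [NormedAddCommGroup E] [NormedSpace ℝ E]
    (hE : ¬ FiniteDimensional ℝ E) :
    ∃ (y : ℕ → E) (F : ℕ → Submodule ℝ E), (∀ n, ‖y n‖ = 1) ∧ (∀ m n, m < n → y m ∈ F n) ∧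
      ∀ n, ∀ v ∈ F n, 1 / 2 ≤ ‖y n - v‖ := by
  choose y hy1 hy2 using fun F : {F : Submodule ℝ E // FiniteDimensional ℝ F} =>
    have := F.2; exists_unit_vector_far hE F.1
  -- The recursion runs on the subspaces: each one adjoins the vector chosen far from it.
  let next : {F : Submodule ℝ E // FiniteDimensional ℝ F} →
      {F : Submodule ℝ E // FiniteDimensional ℝ F} := fun F =>
    ⟨F.1 ⊔ Submodule.span ℝ {y F}, by have := F.2; infer_instance⟩
  let G : ℕ → {F : Submodule ℝ E // FiniteDimensional ℝ F} := fun n =>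
    next^[n] ⟨⊥, inferInstance⟩
  have hG : ∀ n, G (n + 1) = next (G n) := fun n => Function.iterate_succ_apply' _ _ _
  have hmono : Monotone fun n => (G n).1 := by
    refine monotone_nat_of_le_succ fun n => ?_
    rw [hG]
    exact le_sup_left
  refine ⟨fun n => y (G n), fun n => (G n).1, fun n => hy1 _, fun m n hmn => ?_,
    fun n v hv => hy2 _ v hv⟩
  refine hmono (Nat.succ_le_of_lt hmn) ?_
  change y (G m) ∈ (G (m + 1)).1
  rw [hG]
  exact Submodule.mem_sup_right (Submodule.mem_span_singleton_self _)

theorem Real.smoothTransition.exists_lipschitzWith :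
    ∃ L, LipschitzWith L Real.smoothTransition := by
  have hc : Continuous (deriv Real.smoothTransition) :=
    (Real.smoothTransition.contDiff (n := 1)).continuous_deriv le_rfl
  have hs : HasCompactSupport (deriv Real.smoothTransition) := by
    refine HasCompactSupport.of_support_subset_isCompact (isCompact_Icc (a := (0 : ℝ)) (b := 1)) ?_
    intro x hx
    by_contra hx'
    apply hx
    rw [Set.mem_Icc, not_and_or, not_le, not_le] at hx'
    rcases hx' with h | h
    · have : Real.smoothTransition =ᶠ[𝓝 x] fun _ => 0 := by
        filter_upwards [Iio_mem_nhds h] with t ht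
        exact Real.smoothTransition.zero_of_nonpos (le_of_lt ht)
      simp [this.deriv_eq]
    · have : Real.smoothTransition =ᶠ[𝓝 x] fun _ => 1 := by
        filter_upwards [Ioi_mem_nhds h] with t ht
        exact Real.smoothTransition.one_of_one_le (le_of_lt ht)
      simp [this.deriv_eq]
  obtain ⟨C, hC⟩ := hc.bounded_above_of_compact_support hs
  refine ⟨C.toNNReal, lipschitzWith_of_nnnorm_deriv_le
    ((Real.smoothTransition.contDiff (n := 1)).differentiable one_ne_zero) fun x => ?_⟩
  rw [← NNReal.coe_le_coe, coe_nnnorm]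
  exact (hC x).trans (Real.le_coe_toNNReal C)

/-- The smooth path that runs through the points of the sequence `y`. -/
noncomputable def polygonalPath {E : Type*} [AddCommGroup E] [Module ℝ E] (y : ℤ → E) (t : ℝ) :
    E :=
  y ⌊t⌋ + Real.smoothTransition (t - ⌊t⌋) • (y (⌊t⌋ + 1) - y ⌊t⌋)

section polygonalPath

variable {E : Type*} [NormedAddCommGroup E] [NormedSpace ℝ E] {y : ℤ → E}

/-- A single formula valid on both sides of the knot `m`: the transition of one of the two adjacent
segments is saturated on each side. This yields smoothness and derivative bounds at the knots. -/
theorem polygonalPath_eq (m : ℤ) {t : ℝ} (h1 : (m : ℝ) - 1 < t) (h2 : t < m + 1) :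
    polygonalPath y t = y m + Real.smoothTransition (t - m) • (y (m + 1) - y m)
      - (1 - Real.smoothTransition (t - m + 1)) • (y m - y (m - 1)) := by
  rcases lt_or_ge t m with h | h
  · have hf : ⌊t⌋ = m - 1 := by
      rw [Int.floor_eq_iff]; push_cast; constructor <;> linarith
    rw [polygonalPath, hf, Real.smoothTransition.zero_of_nonpos (x := t - m) (by linarith)]
    have : t - ((m - 1 : ℤ) : ℝ) = t - m + 1 := by push_cast; ring
    rw [this, sub_add_cancel]
    module
  · have hf : ⌊t⌋ = m := by
      rw [Int.floor_eq_iff]; constructor <;> linarith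
    rw [polygonalPath, hf, Real.smoothTransition.one_of_one_le (x := t - m + 1) (by linarith)]
    module

theorem polygonalPath_eventuallyEq (t : ℝ) : ∃ m : ℤ, polygonalPath y =ᶠ[𝓝 t] fun t =>
    y m + Real.smoothTransition (t - m) • (y (m + 1) - y m)
      - (1 - Real.smoothTransition (t - m + 1)) • (y m - y (m - 1)) := by
  refine ⟨⌊t⌋, ?_⟩
  filter_upwards [Ioo_mem_nhds (a := (⌊t⌋ : ℝ) - 1) (b := ⌊t⌋ + 1) (x := t)
    (by linarith [Int.floor_le t]) (Int.lt_floor_add_one t)] with s hs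
  exact polygonalPath_eq _ hs.1 hs.2

theorem contDiff_polygonalPath {n : ℕ∞} : ContDiff ℝ n (polygonalPath y) := by
  rw [contDiff_iff_contDiffAt]
  intro t
  obtain ⟨m, hm⟩ := polygonalPath_eventuallyEq (y := y) t
  have hT : ContDiff ℝ n Real.smoothTransition := Real.smoothTransition.contDiff
  refine ContDiffAt.congr_of_eventuallyEq (ContDiff.contDiffAt ?_) hm
  fun_prop

theorem norm_polygonalPath_le {C : ℝ} (hy : ∀ m, ‖y m‖ ≤ C) (t : ℝ) :
    ‖polygonalPath y t‖ ≤ 3 * C := by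
  have h0 := Real.smoothTransition.nonneg (t - ⌊t⌋)
  have h1 := Real.smoothTransition.le_one (t - ⌊t⌋)
  have h2 : ‖y (⌊t⌋ + 1) - y ⌊t⌋‖ ≤ 2 * C :=
    (norm_sub_le _ _).trans (by linarith [hy (⌊t⌋ + 1), hy ⌊t⌋])
  calc ‖polygonalPath y t‖
      ≤ ‖y ⌊t⌋‖ + Real.smoothTransition (t - ⌊t⌋) * ‖y (⌊t⌋ + 1) - y ⌊t⌋‖ := by
        refine (norm_add_le _ _).trans_eq ?_
        rw [norm_smul, Real.norm_of_nonneg h0]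
    _ ≤ C + 1 * (2 * C) := by
        gcongr
        exact hy _
    _ = 3 * C := by ring

theorem exists_lipschitzWith_polygonalPath {C : ℝ} (hy : ∀ m, ‖y m‖ ≤ C) :
    ∃ L, LipschitzWith L (polygonalPath y) := by
  obtain ⟨L, hL⟩ := Real.smoothTransition.exists_lipschitzWith
  have hC : 0 ≤ C := (norm_nonneg _).trans (hy 0)
  have hd : ∀ m, ‖y (m + 1) - y m‖ ≤ 2 * C := fun m =>
    (norm_sub_le _ _).trans (by linarith [hy (m + 1), hy m])
  have hT : ∀ x, HasDerivAt Real.smoothTransition (deriv Real.smoothTransition x) x := fun x =>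
    ((Real.smoothTransition.contDiff (n := 1)).differentiable one_ne_zero x).hasDerivAt
  have hTb : ∀ x, ‖deriv Real.smoothTransition x‖ ≤ L := fun x => norm_deriv_le_of_lipschitz hL
  refine ⟨(4 * C * L).toNNReal, lipschitzWith_of_nnnorm_deriv_le
    ((contDiff_polygonalPath (n := 1)).differentiable one_ne_zero) fun t => ?_⟩
  rw [← NNReal.coe_le_coe, coe_nnnorm]
  refine le_trans ?_ (Real.le_coe_toNNReal _)
  obtain ⟨m, hm⟩ := polygonalPath_eventuallyEq (y := y) t
  have h1 := ((hT (t - m)).comp_sub_const t (m : ℝ)).smul_const (y (m + 1) - y m)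
  have h2 := (((hT (t - m + 1)).comp_add_const (t - m) 1).comp_sub_const t (m : ℝ)
    |>.const_sub 1).smul_const (y m - y (m - 1))
  rw [((h1.const_add (y m)).sub h2 |>.congr_of_eventuallyEq hm).deriv]
  have hd' := hd (m - 1)
  rw [sub_add_cancel] at hd'
  refine (norm_sub_le _ _).trans ?_
  rw [norm_smul, norm_smul, norm_neg]
  calc _ ≤ L * (2 * C) + L * (2 * C) := by
        gcongr
        exacts [hTb _, hd m, hTb _]
    _ = 4 * C * L := by ring

end polygonalPath

/-- In an infinite dimensional space there is a bounded smooth Lipschitz path whose successive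
turns stay far from each other. -/
theorem exists_bounded_path_far_turns {E : Type*} [NormedAddCommGroup E] [NormedSpace ℝ E]
    (hE : ¬ FiniteDimensional ℝ E) (R : ℝ) :
    ∃ c : ℝ → E, (∀ n : ℕ∞, ContDiff ℝ n c) ∧ (∃ C, ∀ s, ‖c s‖ ≤ C) ∧ (∃ L, LipschitzWith L c) ∧
      ∀ s, 0 ≤ s → ∀ k : ℕ, 1 ≤ k → R ≤ ‖c (s + k) - c s‖ := by
  obtain ⟨y, F, hy1, hyF, hyfar⟩ := exists_seq_far_from_span hE
  -- Negative indices all repeat `y 0`; separation is only claimed for `0 ≤ s`.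
  let Y : ℤ → E := fun m => y m.toNat
  have hY : ∀ m, ‖Y m‖ ≤ 1 := fun m => (hy1 _).le
  have hsep : ∀ s : ℝ, 0 ≤ s → ∀ k : ℕ, 1 ≤ k →
      1 / 18 ≤ ‖polygonalPath Y (s + k) - polygonalPath Y s‖ := by
    intro s hs k hk
    obtain ⟨m, hm⟩ := Int.eq_ofNat_of_zero_le (Int.floor_nonneg.2 hs)
    have hfl : ⌊s + (k : ℝ)⌋ = ((m + k : ℕ) : ℤ) := by
      rw [Int.floor_add_natCast, hm]; push_cast; rfl
    set τ := Real.smoothTransition (s - m) with hτ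
    have h0 : 0 ≤ τ := Real.smoothTransition.nonneg _
    have h1 : polygonalPath Y s = y m + τ • (y (m + 1) - y m) := by
      rw [polygonalPath, hm]
      simp only [Y, hτ]
      norm_cast
    have h2 : polygonalPath Y (s + k) =
        y (m + k) + τ • (y (m + k + 1) - y (m + k)) := by
      have : s + k - ((m + k : ℕ) : ℤ) = s - m := by push_cast; ring
      rw [polygonalPath, hfl, this]
      simp only [Y, hτ]
      norm_cast
    set D := polygonalPath Y (s + k) - polygonalPath Y s with hD
    -- Here `D = (1 - τ)(y (m+k) - y m) + τ (y (m+k+1) - y (m+1))`. The vector of highest index has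
    -- coefficient `τ` and the rest lies in the span of its predecessors.
    have hfar : τ / 2 ≤ ‖D‖ := by
      rcases h0.eq_or_lt with h | h
      · rw [← h]; simp
      · have hv := hyfar (m + k + 1)
          (y (m + k + 1) - τ⁻¹ • D) (by
            have : y (m + k + 1) - τ⁻¹ • D =
                y (m + k) - τ⁻¹ • (y (m + k) - y m) + (y (m + 1) - y m) := by
              rw [hD, h1, h2]
              simp only [smul_sub, smul_add, smul_smul, inv_mul_cancel₀ h.ne']
              module
            rw [this]
            have a1 : y (m + k) ∈ F (m + k + 1) := hyF _ _ (by omega)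
            have a2 : y m ∈ F (m + k + 1) := hyF _ _ (by omega)
            have a3 : y (m + 1) ∈ F (m + k + 1) := hyF _ _ (by omega)
            exact (F _).add_mem ((F _).sub_mem a1 ((F _).smul_mem _ ((F _).sub_mem a1 a2)))
              ((F _).sub_mem a3 a2))
        rw [sub_sub_cancel, norm_smul, norm_inv, Real.norm_of_nonneg h0, inv_mul_eq_div,
          le_div_iff₀ h] at hv
        linarith
    -- For small `τ`, `D` is a perturbation of size at most `4τ` of `y (m+k) - y m`, whose norm is
    -- at least `1/2`.
    have hnear : 1 / 2 - 4 * τ ≤ ‖D‖ := by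
      have a := hyfar (m + k) (y m) (hyF _ _ (by omega))
      have b : y (m + k) - y m = D - τ • (y (m + k + 1) - y (m + k) - (y (m + 1) - y m)) := by
        rw [hD, h1, h2]; module
      have c : ‖y (m + k + 1) - y (m + k) - (y (m + 1) - y m)‖ ≤ 4 := by
        refine (norm_sub_le _ _).trans ?_
        have := norm_sub_le (y (m + k + 1)) (y (m + k))
        have := norm_sub_le (y (m + 1)) (y m)
        rw [hy1, hy1] at *
        linarith
      have d := norm_sub_le D (τ • (y (m + k + 1) - y (m + k) - (y (m + 1) - y m)))
      rw [← b, norm_smul, Real.norm_of_nonneg h0] at d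
      nlinarith
    -- Eight times `hfar` plus `hnear` gives `1/2 ≤ 9‖D‖`, whence the constant `1/18`.
    linarith
  obtain ⟨L, hL⟩ := exists_lipschitzWith_polygonalPath hY
  refine ⟨fun s => (18 * |R|) • polygonalPath Y s, fun n => contDiff_polygonalPath.const_smul _,
    ⟨18 * |R| * (3 * 1), fun s => ?_⟩, ⟨‖(18 * |R|)‖₊ * L, ?_⟩, fun s hs k hk => ?_⟩
  · rw [norm_smul, Real.norm_of_nonneg (by positivity)]
    gcongr
    exact norm_polygonalPath_le hY s
  · exact (lipschitzWith_smul (18 * |R|)).comp hL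
  · rw [← smul_sub, norm_smul, Real.norm_of_nonneg (by positivity)]
    calc R ≤ |R| := le_abs_self R
      _ = 18 * |R| * (1 / 18) := by ring
      _ ≤ _ := by gcongr; exact hsep s hs k hk

/-! ### Bounded Lipschitz products and periodization -/

theorem LipschitzWith.mul_of_bounded {α : Type*} [PseudoMetricSpace α] {u v : α → ℝ}
    {Ku Kv A B : NNReal} (hu : LipschitzWith Ku u) (hv : LipschitzWith Kv v)
    (hA : ∀ x, |u x| ≤ A) (hB : ∀ x, |v x| ≤ B) :
    LipschitzWith (A * Kv + B * Ku) fun x => u x * v x := by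
  refine LipschitzWith.of_dist_le_mul fun x y => ?_
  have h1 := hu.dist_le_mul x y
  have h2 := hv.dist_le_mul x y
  rw [Real.dist_eq] at *
  have h : u x * v x - u y * v y = u x * (v x - v y) + v y * (u x - u y) := by ring
  calc |u x * v x - u y * v y| ≤ |u x| * |v x - v y| + |v y| * |u x - u y| := by
        rw [h, ← abs_mul, ← abs_mul]; exact abs_add_le _ _
    _ ≤ A * (Kv * dist x y) + B * (Ku * dist x y) := by
        gcongr
        exacts [hA x, hB y]
    _ = _ := by push_cast; ring

/-- The sum of the integer translates of a function in its real variable. -/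
noncomputable def periodize {X : Type*} (g : ℝ × X → ℝ) (q : ℝ × X) : ℝ :=
  ∑' k : ℤ, g (q.1 + k, q.2)

section periodize

theorem periodize_add_int {X : Type*} (g : ℝ × X → ℝ) (s : ℝ) (x : X) (m : ℤ) :
    periodize g (s + m, x) = periodize g (s, x) := by
  unfold periodize
  rw [← (Equiv.addLeft m).tsum_eq (fun k : ℤ => g (s + k, x))]
  refine tsum_congr fun k => ?_
  simp [add_assoc]

theorem exists_ne_zero_of_periodize_ne_zero {X : Type*} {g : ℝ × X → ℝ} {q : ℝ × X} (hq : periodize g q ≠ 0) :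
    ∃ k : ℤ, g (q.1 + k, q.2) ≠ 0 := by
  by_contra! h
  exact hq (by simp [periodize, h])

variable {X : Type*} [NormedAddCommGroup X] {g : ℝ × X → ℝ} {ε : ℝ}

/-- Integer translates of the support of `g` are uniformly apart. -/
def SeparatedTranslates (g : ℝ × X → ℝ) (ε : ℝ) : Prop :=
  ∀ q q' : ℝ × X, ∀ k k' : ℤ, dist q q' < ε → g (q.1 + k, q.2) ≠ 0 → g (q'.1 + k', q'.2) ≠ 0 →
    k = k'

/-- Two points of the ball of radius `ε / 2` are less than `ε` apart, so at most one index
contributes on the whole ball. Smoothness, range and derivative bounds thus pass from `g` to the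
sum. -/
theorem SeparatedTranslates.periodize_eventuallyEq (hg : SeparatedTranslates g ε) (hε : 0 < ε)
    (q : ℝ × X) : ∃ k : ℤ, periodize g =ᶠ[𝓝 q] fun q => g (q + ((k : ℝ), 0)) := by
  have key : ∃ k : ℤ, ∀ q' ∈ Metric.ball q (ε / 2), ∀ k' ≠ k, g (q'.1 + k', q'.2) = 0 := by
    by_cases h : ∃ q₁ ∈ Metric.ball q (ε / 2), ∃ k : ℤ, g (q₁.1 + k, q₁.2) ≠ 0
    · obtain ⟨q₁, hq₁, k, hk⟩ := h
      refine ⟨k, fun q' hq' k' hk' => ?_⟩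
      by_contra hne
      refine hk' (hg q' q₁ k' k ?_ hne hk)
      have := dist_triangle_right q' q₁ q
      rw [Metric.mem_ball] at hq' hq₁
      linarith
    · push Not at h
      exact ⟨0, fun q' hq' k' _ => h q' hq' k'⟩
  obtain ⟨k, hk⟩ := key
  refine ⟨k, ?_⟩
  filter_upwards [Metric.ball_mem_nhds q (half_pos hε)] with q' hq'
  rw [periodize, tsum_eq_single k (hk q' hq')]
  simp [Prod.add_def]

theorem SeparatedTranslates.periodize_eq (hg : SeparatedTranslates g ε) (hε : 0 < ε)
    {q : ℝ × X} (hq : g q ≠ 0) : periodize g q = g q := by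
  rw [periodize, tsum_eq_single 0]
  · simp
  · intro k hk
    by_contra h
    exact hk (hg q q k 0 (by simpa using hε) h (by simpa using hq))

theorem SeparatedTranslates.periodize_mem (hg : SeparatedTranslates g ε) (hε : 0 < ε)
    {I : Set ℝ} (hI : ∀ q, g q ∈ I) (q : ℝ × X) : periodize g q ∈ I := by
  obtain ⟨k, hk⟩ := hg.periodize_eventuallyEq hε q
  rw [hk.eq_of_nhds]
  exact hI _

variable [NormedSpace ℝ X]

theorem SeparatedTranslates.contDiff_periodize (hg : SeparatedTranslates g ε) (hε : 0 < ε)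
    {n : WithTop ℕ∞} (h : ContDiff ℝ n g) : ContDiff ℝ n (periodize g) := by
  rw [contDiff_iff_contDiffAt]
  intro q
  obtain ⟨k, hk⟩ := hg.periodize_eventuallyEq hε q
  exact (h.comp (contDiff_id.add contDiff_const)).contDiffAt.congr_of_eventuallyEq hk

theorem SeparatedTranslates.lipschitzWith_periodize (hg : SeparatedTranslates g ε) (hε : 0 < ε)
    (h : ContDiff ℝ 1 g) {L : NNReal} (hL : LipschitzWith L g) :
    LipschitzWith L (periodize g) := by
  refine lipschitzWith_of_nnnorm_fderiv_le (𝕜 := ℝ)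
    ((hg.contDiff_periodize hε h).differentiable one_ne_zero) fun q => ?_
  obtain ⟨k, hk⟩ := hg.periodize_eventuallyEq hε q
  rw [hk.fderiv_eq, fderiv_comp_add_right]
  exact norm_fderiv_le_of_lipschitz ℝ hL

end periodize

/-! ### The climbing factor, the radial cutoff and the argument -/

/-- A shifted `expNegInvGlue`. Its derivative must be positive wherever the function is, since that
derivative alone keeps the final one out of `W`; `smoothTransition`, eventually constant, would not
do. -/
theorem exists_smooth_increasing_function : ∃ a : ℝ → ℝ, (∀ n : ℕ∞, ContDiff ℝ n a) ∧
    (∀ s ≤ 1, a s = 0) ∧ (∀ s, 1 < s → 0 < a s) ∧ (∀ s, 1 < s → 0 < deriv a s) ∧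
    (∀ s, 0 ≤ a s) ∧ (∀ s, a s ≤ 1) ∧ ∃ L, LipschitzWith L a := by
  have hd : ∀ s, 0 < s → HasDerivAt expNegInvGlue (Real.exp (-s⁻¹) * (s ^ 2)⁻¹) s := by
    intro s hs
    have h := ((hasDerivAt_inv hs.ne').neg).exp
    rw [neg_neg] at h
    refine h.congr_of_eventuallyEq ?_
    filter_upwards [Ioi_mem_nhds hs] with t ht
    simp [expNegInvGlue, not_le.2 (Set.mem_Ioi.1 ht)]
  have hle : ∀ s, expNegInvGlue s ≤ 1 := by
    intro s
    rw [expNegInvGlue]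
    split_ifs with h
    · exact zero_le_one
    · exact Real.exp_le_one_iff.2 (by have := inv_pos.2 (not_le.1 h); linarith)
  have hLip : LipschitzWith 2 expNegInvGlue := by
    refine lipschitzWith_of_nnnorm_deriv_le
      ((expNegInvGlue.contDiff (n := 1)).differentiable one_ne_zero) fun s => ?_
    rw [← NNReal.coe_le_coe, coe_nnnorm]
    rcases le_or_gt s 0 with h | h
    · have : IsLocalMin expNegInvGlue s := by
        refine Filter.Eventually.of_forall fun t => ?_
        rw [expNegInvGlue.zero_of_nonpos h]
        exact expNegInvGlue.nonneg t
      rw [this.deriv_eq_zero]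
      simp
    · rw [(hd s h).deriv, Real.norm_of_nonneg (by positivity)]
      -- With `u = s⁻¹` the derivative is `u² exp (-u)`, at most `2` because `exp u ≥ 1 + u + u²/2`.
      have h1 := Real.quadratic_le_exp_of_nonneg (inv_pos.2 h).le
      have h2 : 0 < s⁻¹ := inv_pos.2 h
      rw [Real.exp_neg, ← inv_pow, inv_mul_le_iff₀ (Real.exp_pos _)]
      push_cast
      nlinarith
  refine ⟨fun s => expNegInvGlue (s - 1), fun n => expNegInvGlue.contDiff.comp
    (contDiff_id.sub contDiff_const), fun s hs => expNegInvGlue.zero_of_nonpos (by linarith),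
    fun s hs => expNegInvGlue.pos_of_pos (by linarith), fun s hs => ?_,
    fun s => expNegInvGlue.nonneg _, fun s => hle _, 2, ?_⟩
  · have hs' : 0 < s - 1 := by linarith
    rw [((hd _ hs').comp_sub_const s 1).deriv]
    positivity
  · refine LipschitzWith.of_dist_le_mul fun x y => ?_
    simpa using hLip.dist_le_mul (x - 1) (y - 1)

theorem exists_annulus_bump : ∃ β : ℂ → ℝ, (∀ n : ℕ∞, ContDiff ℝ n β) ∧ (∀ z, 0 ≤ β z) ∧
    (∀ z, β z ≤ 1) ∧ (∃ z, β z ≠ 0) ∧ (∀ z, β z ≠ 0 → 1 < ‖z‖) ∧ (∀ z, β z ≠ 0 → ‖z‖ ≤ 2) ∧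
    (∀ z w, ‖z‖ = ‖w‖ → β z = β w) ∧ ∃ L, LipschitzWith L β := by
  -- Applied to `‖z‖²`, which is smooth, this bump lives on `3/2 < ‖z‖² < 7/2`, inside the annulus
  -- from `1` to `2`.
  let η : ContDiffBump (5 / 2 : ℝ) := ⟨1 / 2, 1, by norm_num, by norm_num⟩
  have hs : ∀ z : ℂ, η (Complex.normSq z) ≠ 0 → 3 / 2 < ‖z‖ ^ 2 ∧ ‖z‖ ^ 2 < 7 / 2 := by
    intro z hz
    have : Complex.normSq z ∈ Function.support η := hz
    rw [η.support_eq, Metric.mem_ball, Real.dist_eq, abs_lt, Complex.normSq_eq_norm_sq] at this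
    change _ ∧ _ < (1 : ℝ) at this
    have h1 : -(1 : ℝ) < ‖z‖ ^ 2 - 5 / 2 := this.1
    constructor <;> linarith
  have hsm : ∀ n : ℕ∞, ContDiff ℝ n fun z : ℂ => η (Complex.normSq z) := by
    intro n
    have h : ContDiff ℝ n fun z : ℂ => z.re * z.re + z.im * z.im :=
      (Complex.reCLM.contDiff.mul Complex.reCLM.contDiff).add
        (Complex.imCLM.contDiff.mul Complex.imCLM.contDiff)
    exact η.contDiff.comp h
  have h2 : ∀ z, η (Complex.normSq z) ≠ 0 → ‖z‖ ≤ 2 := fun z hz => by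
    nlinarith [(hs z hz).2, norm_nonneg z]
  refine ⟨fun z => η (Complex.normSq z), hsm, fun z => η.nonneg, fun z => η.le_one,
    ⟨(Real.sqrt (5 / 2) : ℝ), ?_⟩, fun z hz => ?_, h2, fun z w h => ?_, ?_⟩
  · simp only [Complex.normSq_ofReal]
    rw [Real.mul_self_sqrt (by norm_num)]
    have : η (5 / 2) = 1 := η.one_of_mem_closedBall (Metric.mem_closedBall_self η.rIn_pos.le)
    rw [this]; exact one_ne_zero
  · nlinarith [(hs z hz).1, norm_nonneg z]
  · simp only [Complex.normSq_eq_norm_sq, h]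
  · refine ContDiff.lipschitzWith_of_hasCompactSupport ?_ (hsm 1) one_ne_zero
    refine HasCompactSupport.of_support_subset_isCompact (isCompact_closedBall (0 : ℂ) 2) ?_
    intro z hz
    simpa using h2 z hz

theorem exists_turn_eq_of_angle_eq {θ ψ : ℝ} (h : (θ : Real.Angle) = ψ) :
    ∃ k : ℤ, θ / (2 * Real.pi) = ψ / (2 * Real.pi) + k := by
  obtain ⟨k, hk⟩ := Real.Angle.angle_eq_iff_two_pi_dvd_sub.1 h
  refine ⟨k, ?_⟩
  have := Real.pi_pos
  field_simp
  linarith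

/-- Outside the unit disc the argument, in turns, has local smooth branches of derivative at
most one. -/
theorem exists_local_turn {z : ℂ} (hz : 1 ≤ ‖z‖) : ∃ a : ℂ → ℝ, (∀ n : ℕ∞, ContDiffAt ℝ n a z) ∧
    ‖fderiv ℝ a z‖ ≤ 1 ∧
    ∀ᶠ w in 𝓝 z, ∃ k : ℤ, a w = Complex.arg w / (2 * Real.pi) + k := by
  have hz0 : z ≠ 0 := fun h => by norm_num [h] at hz
  -- The rotation by `σ`, later `1` or `-1`, moves `z` off the branch cut. The derivative bound
  -- comes from `‖z⁻¹‖ ≤ 1` and `(2π)⁻¹ ≤ 1`.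
  have main : ∀ σ : ℂ, ‖σ‖ = 1 → σ * z ∈ Complex.slitPlane → ∃ a : ℂ → ℝ,
      (∀ n : ℕ∞, ContDiffAt ℝ n a z) ∧ ‖fderiv ℝ a z‖ ≤ 1 ∧
      ∀ᶠ w in 𝓝 z, ∃ k : ℤ, a w = Complex.arg w / (2 * Real.pi) + k := by
    intro σ hσ hσz
    have hσ0 : σ ≠ 0 := fun h => by norm_num [h] at hσ
    have hsm : ∀ n : ℕ∞, ContDiffAt ℝ n (fun w : ℂ => (Complex.log (σ * w)).im) z := by
      intro n
      have h1 : ContDiffAt ℝ n (fun w : ℂ => Complex.log (σ * w)) z :=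
        ContDiffAt.restrict_scalars ℝ
          ((Complex.contDiffAt_log hσz).comp z (contDiffAt_const.mul contDiffAt_id))
      exact Complex.imCLM.contDiff.contDiffAt.comp z h1
    have hfd : HasFDerivAt (fun w : ℂ => (Complex.log (σ * w)).im)
        (Complex.imCLM.comp ((ContinuousLinearMap.toSpanSingleton ℂ
          (σ / (σ * z))).restrictScalars ℝ)) z := by
      have h1 : HasDerivAt (fun w : ℂ => Complex.log (σ * w)) (σ / (σ * z)) z := by
        have := ((hasDerivAt_id z).const_mul σ).clog hσz
        simpa using this
      exact Complex.imCLM.hasFDerivAt.comp z (h1.hasFDerivAt.restrictScalars ℝ)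
    have hpi : (1 : ℝ) ≤ 2 * Real.pi := by linarith [Real.pi_gt_three]
    have hpi0 : 2 * Real.pi ≠ 0 := by positivity
    have hfd' := (hfd.const_mul ((2 * Real.pi)⁻¹)).sub_const (Complex.arg σ / (2 * Real.pi))
    refine ⟨fun w => (2 * Real.pi)⁻¹ * (Complex.log (σ * w)).im - Complex.arg σ / (2 * Real.pi),
      fun n => (contDiffAt_const.mul (hsm n)).sub contDiffAt_const, ?_, ?_⟩
    · rw [hfd'.fderiv]
      refine ContinuousLinearMap.opNorm_le_bound _ zero_le_one fun w => ?_
      have e : σ / (σ * z) = z⁻¹ := by field_simp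
      have h1 : |(w * (σ / (σ * z))).im| ≤ ‖w‖ := by
        refine (Complex.abs_im_le_norm _).trans ?_
        rw [e, norm_mul, norm_inv]
        exact mul_le_of_le_one_right (norm_nonneg _) (inv_le_one_of_one_le₀ hz)
      simp only [smul_apply, ContinuousLinearMap.comp_apply,
        ContinuousLinearMap.coe_restrictScalars', ContinuousLinearMap.toSpanSingleton_apply,
        Complex.imCLM_apply, smul_eq_mul, norm_mul, one_mul, Real.norm_eq_abs] at h1 ⊢
      rw [abs_of_pos (by positivity : 0 < (2 * Real.pi)⁻¹)]
      exact (mul_le_of_le_one_left (abs_nonneg _) (inv_le_one_of_one_le₀ hpi)).trans h1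
    · filter_upwards [isOpen_ne.mem_nhds hz0] with w hw
      have h1 := Complex.arg_mul_coe_angle hσ0 hw
      have h2 : (((Complex.arg (σ * w) - Complex.arg σ : ℝ)) : Real.Angle) = Complex.arg w := by
        rw [Real.Angle.coe_sub, h1]; abel
      obtain ⟨k, hk⟩ := exists_turn_eq_of_angle_eq h2
      refine ⟨k, ?_⟩
      rw [← hk, Complex.log_im]
      ring
  rcases Complex.mem_slitPlane_or_neg_mem_slitPlane hz0 with h | h
  · exact main 1 (by simp) (by simpa using h)
  · exact main (-1) (by simp) (by simpa using h)

/-! ### The bump along the spiral staircase -/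

/-- Given a bump on an infinite dimensional space, there is another one, supported in a tube
around a spiral staircase, whose derivative lies outside the finite dimensional space `W`
wherever it does not vanish. -/
theorem exists_bump_fderiv_notMem {X : Type*} [NormedAddCommGroup X] [NormedSpace ℝ X]
    (hX : ¬ FiniteDimensional ℝ X) (W : Submodule ℝ (StrongDual ℝ X))
    (hW : FiniteDimensional ℝ W) {p : ℕ∞} (hp : 1 ≤ p) {b : X → ℝ} (hb : ContDiff ℝ p b)
    (hb0 : b 0 ≠ 0) (hnn : ∀ x, 0 ≤ b x) (hb1 : ∀ x, b x ≤ 1) {r : ℝ}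
    (hr : ∀ x, b x ≠ 0 → ‖x‖ ≤ r) :
    ∃ f : X → ℝ, IsBump f ∧ ContDiff ℝ p f ∧ (∀ x, 0 ≤ f x) ∧
      (∀ x, f x ≠ 0 → fderiv ℝ f x ∉ W) ∧
      ((∃ K, LipschitzWith K b) → ∃ K, LipschitzWith K f) := by
  obtain ⟨P, i, K, hPi, hWi, hWK, hPK, hK⟩ := exists_plane_splitting hX W hW
  obtain ⟨c, hc, ⟨C, hC⟩, ⟨L, hL⟩, hfar⟩ := exists_bounded_path_far_turns hK (2 * r + 1)
  obtain ⟨a, ha, ha0, hapos, haderiv, hann, ha1, La, haL⟩ := exists_smooth_increasing_function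
  obtain ⟨β, hβ, hβnn, hβ1, ⟨z₀, hz₀⟩, hβgt, hβle, hβrot, Lβ, hβL⟩ := exists_annulus_bump
  have hpp : (1 : WithTop ℕ∞) ≤ p := by exact_mod_cast hp
  let Q : X →L[ℝ] X := ContinuousLinearMap.id ℝ X - i.comp P
  have hQ : ∀ x, Q x = x - i (P x) := fun x => rfl
  let d : ℝ → X := fun s => c s
  have hd : ∀ n : ℕ∞, ContDiff ℝ n d := fun n => K.subtypeL.contDiff.comp (hc n)
  have hdL : LipschitzWith L d := hL
  have hPd : ∀ s, P (d s) = 0 := fun s => hPK _ (c s).2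
  let g : ℝ × X → ℝ := fun q => a q.1 * b (Q q.2 - d q.1)
  have hg : ContDiff ℝ p g :=
    ((ha p).comp contDiff_fst).mul
      (hb.comp ((Q.contDiff.comp contDiff_snd).sub ((hd p).comp contDiff_fst)))
  have hgne : ∀ q, g q ≠ 0 → 1 < q.1 ∧ ‖Q q.2 - d q.1‖ ≤ r := by
    intro q hq
    refine ⟨?_, hr _ (right_ne_zero_of_mul hq)⟩
    by_contra h
    exact left_ne_zero_of_mul hq (ha0 _ (not_lt.1 h))
  have hgI : ∀ q, g q ∈ Set.Icc (0 : ℝ) 1 := fun q =>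
    ⟨mul_nonneg (hann _) (hnn _), mul_le_one₀ (ha1 _) (hnn _) (hb1 _)⟩
  -- Two translates active at points less than `ε` apart would put `d`, at heights a positive number
  -- of whole turns apart, within `2r + (‖Q‖ + L)ε < 2r + 1`, against `hfar`. The factor `a` forces
  -- heights above `1`, so `hfar` applies.
  obtain ⟨ε, hε, hsep⟩ : ∃ ε, 0 < ε ∧ SeparatedTranslates g ε := by
    have hpos : 0 < ‖Q‖ + L + 1 := by positivity
    refine ⟨(‖Q‖ + L + 1)⁻¹, inv_pos.2 hpos, ?_⟩
    have key : ∀ q q' : ℝ × X, ∀ k k' : ℤ, dist q q' < (‖Q‖ + L + 1)⁻¹ →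
        g (q.1 + k, q.2) ≠ 0 → g (q'.1 + k', q'.2) ≠ 0 → ¬ k < k' := by
      intro q q' k k' hqq h h' hlt
      obtain ⟨m, hm⟩ := Int.eq_ofNat_of_zero_le (sub_nonneg.2 hlt.le)
      obtain ⟨h1, h2⟩ := hgne _ h
      obtain ⟨h1', h2'⟩ := hgne _ h'
      simp only at h1 h2 h1' h2'
      have hm1 : 1 ≤ m := by omega
      have h3 := hfar (q.1 + k) (by linarith) m hm1
      have hk : q.1 + (k : ℝ) + (m : ℝ) = q.1 + k' := by
        have : ((k' - k : ℤ) : ℝ) = (m : ℝ) := by rw [hm]; simp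
        push_cast at this
        linarith
      rw [hk] at h3
      change _ ≤ ‖d (q.1 + k') - d (q.1 + k)‖ at h3
      have hmax : dist q.1 q'.1 ≤ dist q q' ∧ dist q.2 q'.2 ≤ dist q q' := by
        rw [Prod.dist_eq]; exact ⟨le_max_left _ _, le_max_right _ _⟩
      have h4 : ‖d (q.1 + k') - d (q'.1 + k')‖ ≤ L * dist q q' := by
        rw [← dist_eq_norm]
        refine (hdL.dist_le_mul _ _).trans ?_
        rw [dist_add_right]
        gcongr
        exact hmax.1
      have h5 : ‖Q q'.2 - Q q.2‖ ≤ ‖Q‖ * dist q q' := by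
        rw [← map_sub]
        refine (Q.le_opNorm _).trans ?_
        gcongr
        rw [← dist_eq_norm, dist_comm]; exact hmax.2
      have h6 : d (q.1 + k') - d (q.1 + k) = (d (q.1 + k') - d (q'.1 + k')) +
          ((Q q'.2 - Q q.2) + ((Q q.2 - d (q.1 + k)) - (Q q'.2 - d (q'.1 + k')))) := by abel
      have h7 : (‖Q‖ + L + 1) * dist q q' < 1 := by
        rwa [← lt_inv_mul_iff₀ hpos, mul_one]
      have h8 : ‖d (q.1 + k') - d (q.1 + k)‖ ≤
          L * dist q q' + (‖Q‖ * dist q q' + (r + r)) := by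
        rw [h6]
        refine (norm_add_le _ _).trans (add_le_add h4 ((norm_add_le _ _).trans
          (add_le_add h5 ((norm_sub_le _ _).trans (add_le_add h2 h2')))))
      have := dist_nonneg (x := q) (y := q')
      nlinarith
    intro q q' k k' hqq h h'
    exact le_antisymm (not_lt.1 (key q' q k' k (by rwa [dist_comm]) h' h))
      (not_lt.1 (key q q' k k' hqq h h'))
  set S : ℝ × X → ℝ := periodize g with hS
  have hSsm : ContDiff ℝ p S := hsep.contDiff_periodize hε hg
  have hSI : ∀ q, S q ∈ Set.Icc (0 : ℝ) 1 := hsep.periodize_mem hε hgI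
  -- The integer jump of `θ` across the branch cut is invisible to the 1-periodic `S`, and near the
  -- origin `β` vanishes.
  let θ : ℂ → ℝ := fun z => Complex.arg z / (2 * Real.pi)
  let f : X → ℝ := fun x => β (P x) * S (θ (P x), x)
  have hf : ∀ x, f x = β (P x) * S (θ (P x), x) := fun x => rfl
  have hfnn : ∀ x, 0 ≤ f x := fun x => mul_nonneg (hβnn _) (hSI _).1
  -- local smooth representations of `f`
  have hfar0 : ∀ x, ‖P x‖ < 1 → f =ᶠ[𝓝 x] fun _ => 0 := by
    intro x hx
    filter_upwards [(isOpen_lt P.continuous.norm continuous_const).mem_nhds hx] with y hy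
    have : β (P y) = 0 := by
      by_contra h
      exact absurd (hβgt _ h) (not_lt.2 (le_of_lt hy))
    simp [hf, this]
  have hlocal : ∀ x, 1 ≤ ‖P x‖ → ∃ u : ℂ → ℝ, (∀ n : ℕ∞, ContDiffAt ℝ n u (P x)) ∧
      ‖fderiv ℝ u (P x)‖ ≤ 1 ∧ f =ᶠ[𝓝 x] fun y => β (P y) * S (u (P y), y) := by
    intro x hx
    obtain ⟨u, hu, hu', hθ⟩ := exists_local_turn hx
    refine ⟨u, hu, hu', ?_⟩
    filter_upwards [P.continuous.continuousAt.eventually hθ] with y hy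
    obtain ⟨k, hk⟩ := hy
    rw [hf, hk, hS, periodize_add_int]
  have hfsm : ContDiff ℝ p f := by
    rw [contDiff_iff_contDiffAt]
    intro x
    rcases lt_or_ge ‖P x‖ 1 with h | h
    · exact contDiffAt_const.congr_of_eventuallyEq (hfar0 x h)
    · obtain ⟨u, hu, -, hfu⟩ := hlocal x h
      refine ContDiffAt.congr_of_eventuallyEq ?_ hfu
      have h1 : ContDiffAt ℝ p (fun y => (u (P y), y)) x :=
        ((hu p).comp x P.contDiff.contDiffAt).prodMk contDiffAt_id
      exact ((hβ p).comp P.contDiff).contDiffAt.mul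
        (hSsm.contDiffAt.comp x h1)
  have hactive : ∀ x, f x ≠ 0 → 1 < ‖P x‖ ∧ ‖P x‖ ≤ 2 ∧ ∃ k : ℤ, g (θ (P x) + k, x) ≠ 0 := by
    intro x hx
    have h1 := left_ne_zero_of_mul hx
    exact ⟨hβgt _ h1, hβle _ h1, exists_ne_zero_of_periodize_ne_zero (right_ne_zero_of_mul hx)⟩
  have hfg : ∀ x (k : ℤ), g (θ (P x) + k, x) ≠ 0 → f x = β (P x) * g (θ (P x) + k, x) := by
    intro x k h
    rw [hf, ← hsep.periodize_eq hε h, periodize_add_int]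
  refine ⟨f, ⟨?_, ?_⟩, hfsm, hfnn, ?_, ?_⟩
  · -- `f` does not vanish identically
    -- Any turn high enough for `a` to be positive will do; the witness is the centre of the tube
    -- there, where `b` is evaluated at `0`.
    obtain ⟨k, hk⟩ := exists_int_gt (1 - θ z₀)
    let s := θ z₀ + k
    have hs : 1 < s := by simp only [s]; linarith
    have hPx : P (i z₀ + d s) = z₀ := by rw [map_add, hPi, hPd, add_zero]
    have hQx : Q (i z₀ + d s) = d s := by rw [hQ, hPx]; abel
    have hgx : g (θ (P (i z₀ + d s)) + k, i z₀ + d s) ≠ 0 := by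
      rw [hPx]
      change a s * b (Q (i z₀ + d s) - d s) ≠ 0
      rw [hQx, sub_self]
      exact mul_ne_zero (hapos s hs).ne' hb0
    refine ⟨i z₀ + d s, ?_⟩
    rw [hfg _ k hgx]
    exact mul_ne_zero (by rwa [hPx]) hgx
  · -- the support of `f` is bounded
    refine (Metric.isBounded_closedBall (x := (0 : X)) (r := ‖i‖ * 2 + (r + C))).subset ?_
    refine closure_minimal (fun x hx => ?_) Metric.isClosed_closedBall
    obtain ⟨-, h2, k, hk⟩ := hactive x hx
    rw [mem_closedBall_zero_iff]
    have h3 : x = i (P x) + ((Q x - d (θ (P x) + k)) + d (θ (P x) + k)) := by rw [hQ]; abel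
    have h4 : ‖i (P x)‖ ≤ ‖i‖ * 2 :=
      (i.le_opNorm _).trans (mul_le_mul_of_nonneg_left h2 (norm_nonneg _))
    rw [h3]
    exact (norm_add_le _ _).trans (add_le_add h4 ((norm_add_le _ _).trans
      (add_le_add (hgne _ hk).2 (hC _))))
  · -- `f` has a nonzero derivative in a direction annihilated by `W`
    intro x hx hmem
    obtain ⟨h1, -, k, hk⟩ := hactive x hx
    have hz : P x ≠ 0 := fun h => by rw [h, norm_zero] at h1; linarith
    set s := θ (P x) + k with hs
    have hs1 : 1 < s := (hgne _ hk).1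
    have hβx : β (P x) ≠ 0 := left_ne_zero_of_mul hx
    have hbx : b (Q x - d s) ≠ 0 := right_ne_zero_of_mul hk
    let e : ℝ → ℂ := fun t => Complex.exp ((2 * Real.pi * t : ℝ) * Complex.I)
    have he : HasDerivAt e (2 * Real.pi * Complex.I) 0 := by
      have h : HasDerivAt (fun t : ℝ => ((2 * Real.pi * t : ℝ) : ℂ)) (2 * Real.pi) 0 := by
        have := ((hasDerivAt_id (0 : ℝ)).const_mul (2 * Real.pi)).ofReal_comp
        simpa using this
      have := (h.mul_const Complex.I).cexp
      simpa [e] using this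
    -- Climbing the staircase: the plane coordinate makes `t` turns while the transverse one follows
    -- `d`, so `Q (γ t) - d (s + t)` and `‖P (γ t)‖` are constant. Only `a (s + t)` varies.
    let γ : ℝ → X := fun t => i (e t * P x) + (Q x + (d (s + t) - d s))
    have hPQ : P (Q x) = 0 := by rw [hQ, map_sub, hPi, sub_self]
    have hPγ : ∀ t, P (γ t) = e t * P x := by
      intro t
      simp only [γ, map_add, map_sub, hPi, hPQ, hPd]
      simp
    have hQγ : ∀ t, Q (γ t) = Q x + (d (s + t) - d s) := by
      intro t
      rw [hQ, hPγ]; simp only [γ]; abel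
    have hγ0 : γ 0 = x := by
      simp only [γ, e, hQ]; simp
    have hγd : HasDerivAt γ (i (2 * Real.pi * Complex.I * P x) + (deriv c s : K)) 0 := by
      have hcd : HasDerivAt c (deriv c s) (s + 0) := by
        rw [add_zero]
        exact ((hc 1).differentiable one_ne_zero s).hasDerivAt
      have h2 : HasDerivAt (fun t => d (s + t)) (deriv c s : K) 0 :=
        (K.subtypeL.hasFDerivAt.comp_hasDerivAt (s + 0) hcd).comp_const_add s 0
      exact (i.hasFDerivAt.comp_hasDerivAt 0 (he.mul_const (P x))).add
        ((h2.sub_const (d s)).const_add (Q x))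
    have hturn : ∀ t : ℝ, ∃ m : ℤ, s + t = θ (P (γ t)) + m := by
      intro t
      have hang : ((Complex.arg (P x) + 2 * Real.pi * t : ℝ) : Real.Angle) =
          Complex.arg (P (γ t)) := by
        rw [hPγ, Complex.arg_mul_coe_angle (Complex.exp_ne_zero _) hz, Complex.arg_exp_mul_I, Real.Angle.coe_toIocMod,
          Real.Angle.coe_add, add_comm]
      obtain ⟨m, hm⟩ := exists_turn_eq_of_angle_eq hang
      -- The height `s` already includes `k` full turns.
      refine ⟨m + k, ?_⟩
      have hpi := Real.pi_pos
      have : (Complex.arg (P x) + 2 * Real.pi * t) / (2 * Real.pi) = θ (P x) + t := by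
        simp only [θ]; field_simp
      rw [this] at hm
      push_cast
      rw [hs]
      change _ = θ (P (γ t)) + m at hm
      linarith
    have hfγ : (fun t => f (γ t)) =ᶠ[𝓝 0] fun t => β (P x) * (a (s + t) * b (Q x - d s)) := by
      have : ∀ᶠ t in 𝓝 (0 : ℝ), 1 < s + t := by
        refine (continuous_const.add continuous_id).continuousAt.eventually_const_lt ?_
        simpa using hs1
      filter_upwards [this] with t ht
      obtain ⟨m, hm⟩ := hturn t
      have hval : g (θ (P (γ t)) + m, γ t) = a (s + t) * b (Q x - d s) := by
        rw [← hm]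
        change a (s + t) * b (Q (γ t) - d (s + t)) = _
        rw [hQγ]
        congr 2
        abel
      have hne : g (θ (P (γ t)) + m, γ t) ≠ 0 := by
        rw [hval]; exact mul_ne_zero (hapos _ ht).ne' hbx
      rw [hfg _ m hne, hval, hPγ]
      congr 1
      refine hβrot _ _ ?_
      rw [norm_mul, Complex.norm_exp_ofReal_mul_I, one_mul]
    have hd1 : HasDerivAt (fun t => f (γ t)) (β (P x) * (deriv a s * b (Q x - d s))) 0 := by
      refine HasDerivAt.congr_of_eventuallyEq ?_ hfγ
      have had : HasDerivAt a (deriv a s) (s + 0) := by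
        rw [add_zero]
        exact ((ha 1).differentiable one_ne_zero s).hasDerivAt
      exact ((had.comp_const_add s 0).mul_const _).const_mul _
    have hd2 : HasDerivAt (fun t => f (γ t))
        (fderiv ℝ f x (i (2 * Real.pi * Complex.I * P x) + (deriv c s : K))) 0 := by
      have h2 : HasFDerivAt f (fderiv ℝ f x) (γ 0) := by
        rw [hγ0]
        exact ((hfsm.of_le hpp).differentiable one_ne_zero x).hasFDerivAt
      exact h2.comp_hasDerivAt 0 hγd
    have hzero : fderiv ℝ f x (i (2 * Real.pi * Complex.I * P x) + (deriv c s : K)) = 0 := by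
      rw [map_add, hWi _ hmem, hWK _ hmem _ (deriv c s).2, add_zero]
    have := hd1.unique hd2
    rw [hzero] at this
    exact mul_ne_zero hβx (mul_ne_zero (haderiv s hs1).ne' hbx) this
  · rintro ⟨Kb, hbL⟩
    have hgL : ∃ Kg, LipschitzWith Kg g := by
      have h1 : LipschitzWith (Kb * (‖Q‖₊ * 1 + L * 1)) fun q : ℝ × X => b (Q q.2 - d q.1) :=
        hbL.comp ((Q.lipschitz.comp LipschitzWith.prod_snd).sub
          (hdL.comp LipschitzWith.prod_fst))
      exact ⟨_, (haL.comp LipschitzWith.prod_fst).mul_of_bounded h1 (A := 1) (B := 1)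
        (fun q => by exact (abs_of_nonneg (hann q.1)).trans_le (ha1 q.1))
        (fun q => by rw [abs_of_nonneg (hnn _)]; exact hb1 _)⟩
    obtain ⟨Kg, hgL⟩ := hgL
    have hSL : LipschitzWith Kg S := hsep.lipschitzWith_periodize hε (hg.of_le hpp) hgL
    -- Product rule with `|β|, |S| ≤ 1`: `S` is composed with `y ↦ (u (P y), y)`, whose derivative
    -- has norm at most `‖P‖ + 1` because `‖u'‖ ≤ 1`. The bound is uniform since no choice of branch
    -- enters it.
    let M : NNReal := Kg * (‖P‖₊ + 1) + Lβ * ‖P‖₊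
    refine ⟨M, lipschitzWith_of_nnnorm_fderiv_le (𝕜 := ℝ)
      ((hfsm.of_le hpp).differentiable one_ne_zero) fun x => ?_⟩
    rw [← NNReal.coe_le_coe, coe_nnnorm]
    rcases lt_or_ge ‖P x‖ 1 with h | h
    · rw [(hfar0 x h).fderiv_eq]
      simp
    · obtain ⟨u, hu, hu1, hfu⟩ := hlocal x h
      have hud : HasFDerivAt u (fderiv ℝ u (P x)) (P x) :=
        ((hu 1).differentiableAt one_ne_zero).hasFDerivAt
      have hSd : HasFDerivAt S (fderiv ℝ S (u (P x), x)) (u (P x), x) :=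
        ((hSsm.of_le hpp).differentiable one_ne_zero _).hasFDerivAt
      have hβd : HasFDerivAt β (fderiv ℝ β (P x)) (P x) :=
        ((hβ 1).differentiable one_ne_zero _).hasFDerivAt
      have h1 : HasFDerivAt (fun y => (u (P y), y))
          (((fderiv ℝ u (P x)).comp P).prod (ContinuousLinearMap.id ℝ X)) x :=
        (hud.comp x P.hasFDerivAt).prodMk (hasFDerivAt_id x)
      have h2 := HasFDerivAt.comp (g := S) (f := fun y => (u (P y), y)) x hSd h1
      have h3 := hβd.comp x P.hasFDerivAt
      rw [((h3.mul h2).congr_of_eventuallyEq hfu).fderiv]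
      have n1 : ‖((fderiv ℝ u (P x)).comp P).prod (ContinuousLinearMap.id ℝ X)‖ ≤ ‖P‖ + 1 := by
        refine ContinuousLinearMap.opNorm_le_bound _ (by positivity) fun y => ?_
        rw [ContinuousLinearMap.prod_apply, Prod.norm_def]
        refine max_le ?_ ?_
        · calc ‖fderiv ℝ u (P x) (P y)‖ ≤ 1 * (‖P‖ * ‖y‖) :=
                (ContinuousLinearMap.le_opNorm _ _).trans
                  (mul_le_mul hu1 (P.le_opNorm y) (norm_nonneg _) zero_le_one)
            _ ≤ (‖P‖ + 1) * ‖y‖ := by nlinarith [norm_nonneg y]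
        · change ‖y‖ ≤ _
          nlinarith [norm_nonneg y, norm_nonneg P, mul_nonneg (norm_nonneg P) (norm_nonneg y)]
      have n2 : ‖fderiv ℝ S (u (P x), x)‖ ≤ Kg := norm_fderiv_le_of_lipschitz ℝ hSL
      have n3 : ‖fderiv ℝ β (P x)‖ ≤ Lβ := norm_fderiv_le_of_lipschitz ℝ hβL
      refine (norm_add_le _ _).trans ?_
      rw [norm_smul, norm_smul]
      have b1 : ‖β (P x)‖ ≤ 1 := by rw [Real.norm_of_nonneg (hβnn _)]; exact hβ1 _
      have b2 : ‖S (u (P x), x)‖ ≤ 1 := by rw [Real.norm_of_nonneg (hSI _).1]; exact (hSI _).2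
      calc _ ≤ 1 * (Kg * (‖P‖ + 1)) + 1 * (Lβ * ‖P‖) := by
            refine add_le_add (mul_le_mul b1 ?_ (norm_nonneg _) zero_le_one)
              (mul_le_mul b2 ?_ (norm_nonneg _) zero_le_one)
            · exact (ContinuousLinearMap.opNorm_comp_le _ _).trans
                (mul_le_mul n2 n1 (norm_nonneg _) (NNReal.coe_nonneg _))
            · exact (ContinuousLinearMap.opNorm_comp_le _ _).trans
                (mul_le_mul_of_nonneg_right n3 (norm_nonneg _))
        _ = M := by simp only [M]; push_cast; simp

/-! ### Normalization and conclusion -/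

/-- Translate, then compose with `t² / (1 + t²)`, which is smooth, 1-Lipschitz, valued in `[0, 1)`
and zero only at `0`. Nonnegativity settles the derivative at zeros of the final bump; the upper
bound keeps products Lipschitz. -/
theorem IsBump.exists_normalization {X : Type*} [NormedAddCommGroup X] [NormedSpace ℝ X]
    {b : X → ℝ} (hb : IsBump b) {p : ℕ∞} (hp : ContDiff ℝ p b) :
    ∃ (b' : X → ℝ) (r : ℝ), ContDiff ℝ p b' ∧ b' 0 ≠ 0 ∧ (∀ x, 0 ≤ b' x) ∧ (∀ x, b' x ≤ 1) ∧
      (∀ x, b' x ≠ 0 → ‖x‖ ≤ r) ∧ ((∃ K, LipschitzWith K b) → ∃ K, LipschitzWith K b') := by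
  obtain ⟨⟨x₀, hx₀⟩, hbd⟩ := hb
  obtain ⟨r, hr⟩ := hbd.subset_closedBall x₀
  let φ : ℝ → ℝ := fun t => t ^ 2 / (1 + t ^ 2)
  have hpos : ∀ t : ℝ, 0 < 1 + t ^ 2 := fun t => by positivity
  have hφ : ContDiff ℝ p φ :=
    (contDiff_id.pow 2).div (contDiff_const.add (contDiff_id.pow 2)) fun t => (hpos t).ne'
  have hφL : LipschitzWith 1 φ := by
    refine LipschitzWith.of_dist_le_mul fun s t => ?_
    have h : φ s - φ t = (s - t) * ((s + t) / ((1 + s ^ 2) * (1 + t ^ 2))) := by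
      have := hpos s; have := hpos t
      simp only [φ]; field_simp; ring
    rw [Real.dist_eq, Real.dist_eq, h, abs_mul, NNReal.coe_one, one_mul]
    refine mul_le_of_le_one_right (abs_nonneg _) ?_
    rw [abs_div, abs_of_pos (mul_pos (hpos s) (hpos t)),
      div_le_one (mul_pos (hpos s) (hpos t)), abs_le]
    constructor <;> nlinarith [sq_nonneg (s - 1), sq_nonneg (t - 1), sq_nonneg (s + 1),
      sq_nonneg (t + 1), sq_nonneg (s * t)]
  refine ⟨fun x => φ (b (x + x₀)), r, hφ.comp (hp.comp (contDiff_id.add contDiff_const)), ?_,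
    fun x => by positivity, fun x => ?_, fun x hx => ?_, ?_⟩
  · simp only [φ, zero_add]
    have := hpos (b x₀)
    positivity
  · exact (div_le_one (hpos _)).2 (by linarith)
  · have : b (x + x₀) ≠ 0 := fun h => hx (by simp [φ, h])
    simpa [dist_eq_norm] using hr (subset_closure this)
  · rintro ⟨K, hK⟩
    exact ⟨_, hφL.comp (hK.comp (isometry_add_right x₀).lipschitz)⟩

/-- A zero of a nonnegative function is a minimum, so its derivative vanishes there; elsewhere a
nonzero multiple of `f'(x)` lies in `W` only if `f'(x)` does. -/
theorem scaledDerivatives_inter_eq {X : Type*} [NormedAddCommGroup X] [NormedSpace ℝ X]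
    {f : X → ℝ} {W : Submodule ℝ (StrongDual ℝ X)} (hnn : ∀ x, 0 ≤ f x)
    (h : ∀ x, f x ≠ 0 → fderiv ℝ f x ∉ W) :
    scaledDerivatives f ∩ (W : Set (StrongDual ℝ X)) = {0} := by
  ext w
  rw [Set.mem_singleton_iff]
  constructor
  · rintro ⟨⟨x, c, rfl⟩, hw⟩
    by_cases hx : f x = 0
    · have : IsLocalMin f x := Filter.Eventually.of_forall fun y => by rw [hx]; exact hnn y
      rw [this.fderiv_eq_zero, smul_zero]
    · by_cases hc : c = 0
      · rw [hc, zero_smul]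
      · exact absurd ((W.smul_mem_iff hc).1 hw) (h x hx)
  · rintro rfl
    exact ⟨⟨0, 0, (zero_smul _ _).symm⟩, W.zero_mem⟩

theorem image_fderiv_inter_eq_empty {X : Type*} [NormedAddCommGroup X] [NormedSpace ℝ X]
    {f : X → ℝ} {W : Submodule ℝ (StrongDual ℝ X)} (h : ∀ x, f x ≠ 0 → fderiv ℝ f x ∉ W) :
    (fderiv ℝ f '' {x | f x ≠ 0}) ∩ (W : Set (StrongDual ℝ X)) = ∅ := by
  rw [Set.eq_empty_iff_forall_notMem]
  rintro _ ⟨⟨x, hx, rfl⟩, hw⟩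
  exact h x hx hw

theorem corollary4p1 {X : Type*} [NormedAddCommGroup X] [NormedSpace ℝ X] [CompleteSpace X]
    (hX : ¬ FiniteDimensional ℝ X)
    (W : Submodule ℝ (StrongDual ℝ X)) (hW : FiniteDimensional ℝ W)
    (p : ℕ∞) (hp : 1 ≤ p) :
    -- the version without the Lipschitz condition
    ((∃ b : X → ℝ, IsBump b ∧ ContDiff ℝ p b) ↔
      ∃ f : X → ℝ, IsBump f ∧ ContDiff ℝ p f ∧
        scaledDerivatives f ∩ (W : Set (StrongDual ℝ X)) = {0} ∧
        (fderiv ℝ f '' {x | f x ≠ 0}) ∩ (W : Set (StrongDual ℝ X)) = ∅) ∧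
    -- the Lipschitz version
    ((∃ b : X → ℝ, IsBump b ∧ ContDiff ℝ p b ∧ ∃ K, LipschitzWith K b) ↔
      ∃ f : X → ℝ, IsBump f ∧ ContDiff ℝ p f ∧ (∃ K, LipschitzWith K f) ∧
        scaledDerivatives f ∩ (W : Set (StrongDual ℝ X)) = {0} ∧
        (fderiv ℝ f '' {x | f x ≠ 0}) ∩ (W : Set (StrongDual ℝ X)) = ∅) := by
  have key : ∀ b : X → ℝ, IsBump b → ContDiff ℝ p b → ∃ f : X → ℝ, IsBump f ∧ ContDiff ℝ p f ∧
      (∀ x, 0 ≤ f x) ∧ (∀ x, f x ≠ 0 → fderiv ℝ f x ∉ W) ∧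
      ((∃ K, LipschitzWith K b) → ∃ K, LipschitzWith K f) := by
    intro b hb hbp
    obtain ⟨b', r, hb', h0, hnn, h1, hr, hL⟩ := hb.exists_normalization hbp
    obtain ⟨f, hf, hfp, hfnn, hfW, hfL⟩ :=
      exists_bump_fderiv_notMem hX W hW hp hb' h0 hnn h1 hr
    exact ⟨f, hf, hfp, hfnn, hfW, hfL ∘ hL⟩
  refine ⟨⟨?_, ?_⟩, ⟨?_, ?_⟩⟩
  · rintro ⟨b, hb, hbp⟩
    obtain ⟨f, hf, hfp, hfnn, hfW, -⟩ := key b hb hbp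
    exact ⟨f, hf, hfp, scaledDerivatives_inter_eq hfnn hfW, image_fderiv_inter_eq_empty hfW⟩
  · rintro ⟨f, hf, hfp, -⟩
    exact ⟨f, hf, hfp⟩
  · rintro ⟨b, hb, hbp, hbL⟩
    obtain ⟨f, hf, hfp, hfnn, hfW, hfL⟩ := key b hb hbp
    exact ⟨f, hf, hfp, hfL hbL, scaledDerivatives_inter_eq hfnn hfW,
      image_fderiv_inter_eq_empty hfW⟩
  · rintro ⟨f, hf, hfp, hfL, -⟩
    exact ⟨f, hf, hfp, hfL⟩
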